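/- Let $\beta>0$ and $T\ge 1$ be real and let $J$ be a non-negative integer. Put $b=\min\left(\frac1{2\beta},\frac16\right)$, $\zeta=2b(1-b)$ and $\tilde\beta=\max(\beta,3)$. Let $s_1,\dots,s_J$ and $w_1,\dots,w_J$ be the nodes and weights of the $J$-point Gauss–Legendre quadrature rule on $[-1,1]$ (the $s_j$ are the zeros of the Legendre polynomial $P_J$, and $w_j$ is the integral over $[-1,1]$ of the Lagrange basis polynomial equal to $1$ at $s_j$ and to $0$ at the other nodes). Set $$t_j=Ts_j,\qquad z_j=t_j^2-\zeta+\mathrm i t_j,\qquad \varrho_j=-\frac{T}{2\pi\mathrm i}\,w_j\,e^{-\beta z_j}(2t_j+\mathrm i).$$ Thus $\sum_j \varrho_j/(z_j-x)$ is the discretization by this rule of $\frac1{2\pi\mathrm i}\int_\Gamma\frac{e^{-\beta z}}{z-x}\,\mathrm dz$, where $\Gamma$ is the parabola $\{t^2-\zeta+\mathrm i t: t\in\mathbb R\}$ truncated to $t\in[-T,T]$ and oriented counterclockwise around $[0,\infty)$ (that is, with $t$ decreasing). Then, for all real $x\ge0$, $$\left|e^{-\beta x}-\sum_{j=1}^{J}\frac{\varrho_j}{z_j-x}\right|\le\sqrt{\frac{2}{\beta\pi}}\,e^{1-\beta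 T^2}+\frac{64\,T^2\tilde\beta\,e^{3/2}}{1-e^{-1/(8T\tilde\beta)}}\,e^{-J/(4T\tilde\beta)}.$$ (For $J=0$ the sum is empty.) -/

import Mathlib

noncomputable section

namespace ParabolicQuadrature

open Polynomial

/-- The Legendre polynomial `P_n`, by Rodrigues' formula
`P_n = (2 ^ n * n!)⁻¹ * (d/dX) ^ n (X ^ 2 - 1) ^ n`. -/
def legendre (n : ℕ) : ℝ[X] :=
  C (((2 : ℝ) ^ n * (n.factorial : ℝ))⁻¹) * derivative^[n] ((X ^ 2 - 1) ^ n)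

/-- The nodes of the `J`-point Gauss-Legendre rule on `[-1, 1]`: the (real) zeros of `P_J`. -/
def gaussNodes (J : ℕ) : Finset ℝ := (legendre J).roots.toFinset

/-- The weight of the `J`-point Gauss-Legendre rule at the node `s`: the integral over `[-1, 1]`
of the Lagrange basis polynomial that is `1` at `s` and `0` at the other nodes. -/
def gaussWeight (J : ℕ) (s : ℝ) : ℝ :=
  ∫ y in (-1 : ℝ)..1, (Lagrange.basis (gaussNodes J) id s).eval y

/-- The parameter `b = min (1 / (2 β)) (1 / 6)`. -/
def bParam (β : ℝ) : ℝ := min (1 / (2 * β)) (1 / 6)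

/-- The parameter `ζ = 2 b (1 - b)`. -/
def zetaParam (β : ℝ) : ℝ := 2 * bParam β * (1 - bParam β)

/-- The point `t ^ 2 - ζ + i t` of the parabolic contour. -/
def contourPoint (β t : ℝ) : ℂ := (t : ℂ) ^ 2 - (zetaParam β : ℂ) + Complex.I * (t : ℂ)

/-- The residue `ϱ` attached to the node `s`, with `t = T s`. The minus sign is the positive
(counterclockwise) orientation around `[0, ∞)`, along which the parameter `t` decreases. -/
def residue (β T : ℝ) (J : ℕ) (s : ℝ) : ℂ :=
  -((T : ℂ) / (2 * (Real.pi : ℂ) * Complex.I)) * (gaussWeight J s : ℂ)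
    * Complex.exp (-(β : ℂ) * contourPoint β (T * s))
    * (2 * ((T * s : ℝ) : ℂ) + Complex.I)

/-- The rational function `∑ⱼ ϱⱼ / (zⱼ - x)`, where `zⱼ` is the contour point with parameter
`T sⱼ` and `sⱼ` runs through the nodes of the `J`-point Gauss-Legendre rule. -/
def rationalApprox (β T : ℝ) (J : ℕ) (x : ℝ) : ℂ :=
  ∑ s ∈ gaussNodes J, residue β T J s / (contourPoint β (T * s) - (x : ℂ))

end ParabolicQuadrature

end

/-! Put `q = ζ + x`. Shifting the pole from `x` to `0` gives `e^{-βz} = e^{-βx} e^{-β(z-x)}`, where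
`z - x` runs over the parabola `t ^ 2 - q + i t`. Let `I` be the integral of `e^{-βw}/w` along this
parabola for `t ∈ [-T, T]`, and `S` its Gauss sum. For increasing `t` the full parabola contributes
`-2πi`, so the error is `e^{-βx}/(2πi) * ((I + 2πi) - (I - S))`. Both brackets are `O(e^{βx})`, and
the prefactor cancels this growth, which makes the bound uniform in `x`.

Truncation (`norm_integral_cauchyIntegrand_add_two_pi_I_le`): closing the parabola by a distant
vertical segment gives the value `-2πi`, and the two discarded tails are Gaussian.

Quadrature (`norm_integral_sub_gauss_cauchyIntegrand_le`): the integrand is analytic and bounded on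
the strip `|Im t| ≤ b/2`, which contains `T` times the Bernstein ellipse of parameter `ρ = e^h`, `h
= 1/(8 T max β 3)`. Chebyshev coefficients then decay like `ρ^{-n}`. The rule is exact below degree
`2J` and has nonnegative weights, so its error is controlled by the Chebyshev tail, of size `ρ^{-2J}
= e^{-J/(4 T max β 3)}` (`norm_integral_sub_gauss_le`). -/

noncomputable section

/-! ### Gauss–Legendre quadrature: exactness, positivity, best-approximation bound -/

namespace ParabolicQuadrature

open Polynomial

/-- Integration of real polynomials over `[-1, 1]`, as a linear functional. -/
def polyIntegral : ℝ[X] →ₗ[ℝ] ℝ where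
  toFun p := ∫ y in (-1 : ℝ)..1, p.eval y
  map_add' p q := by
    simp only [eval_add]
    exact intervalIntegral.integral_add (p.continuous.intervalIntegrable _ _)
      (q.continuous.intervalIntegrable _ _)
  map_smul' c p := by
    simp only [eval_smul, RingHom.id_apply]
    exact intervalIntegral.integral_smul c _

lemma polyIntegral_apply (p : ℝ[X]) : polyIntegral p = ∫ y in (-1 : ℝ)..1, p.eval y := rfl

lemma polyIntegral_derivative (p : ℝ[X]) :
    polyIntegral (derivative p) = p.eval 1 - p.eval (-1) := by
  rw [polyIntegral_apply]
  exact intervalIntegral.integral_eq_sub_of_hasDerivAt (fun x _ => p.hasDerivAt x)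
    ((derivative p).continuous.intervalIntegrable _ _)

lemma polyIntegral_pos {p : ℝ[X]} (hp : p ≠ 0) (h : ∀ y ∈ Set.Icc (-1 : ℝ) 1, 0 ≤ p.eval y) :
    0 < polyIntegral p := by
  refine intervalIntegral.integral_pos (by norm_num) p.continuous.continuousOn
    (fun y hy => h y (Set.Ioc_subset_Icc_self hy)) ?_
  by_contra! hc
  refine hp (eq_zero_of_infinite_isRoot p ((Set.Icc_infinite (by norm_num : (-1 : ℝ) < 1)).mono ?_))
  exact fun y hy => le_antisymm (hc y hy) (h y hy)

lemma polyIntegral_nonneg {p : ℝ[X]} (h : ∀ y ∈ Set.Icc (-1 : ℝ) 1, 0 ≤ p.eval y) :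
    0 ≤ polyIntegral p :=
  intervalIntegral.integral_nonneg (by norm_num) h

/-- Integration by parts `k` times: fewer than `n` derivatives of `(X ^ 2 - 1) ^ n` leave a factor
`X ^ 2 - 1`, so every boundary term vanishes. -/
lemma polyIntegral_iterate_derivative_mul_eq_zero (n : ℕ) {k : ℕ} (hk : k ≤ n) {q : ℝ[X]}
    (hq : derivative^[k] q = 0) :
    polyIntegral (derivative^[k] ((X ^ 2 - 1) ^ n) * q) = 0 := by
  induction k generalizing q with
  | zero => simp_all
  | succ k ih =>
    have h1 := ih (by omega) (q := derivative q) (by simpa using hq)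
    have hdvd : (X ^ 2 - 1 : ℝ[X]) ∣ derivative^[k] ((X ^ 2 - 1) ^ n) :=
      (dvd_pow_self _ (by omega)).trans (pow_sub_dvd_iterate_derivative_pow _ n k)
    obtain ⟨r, hr⟩ := hdvd
    have h2 := polyIntegral_derivative (derivative^[k] ((X ^ 2 - 1) ^ n) * q)
    rw [derivative_mul, map_add, h1, hr] at h2
    rw [Function.iterate_succ_apply', hr]
    simpa using h2

lemma polyIntegral_legendre_mul_eq_zero {n : ℕ} {q : ℝ[X]} (hq : q.degree < n) :
    polyIntegral (legendre n * q) = 0 := by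
  rw [legendre, mul_assoc, ← smul_eq_C_mul, map_smul,
    polyIntegral_iterate_derivative_mul_eq_zero n le_rfl, smul_zero]
  by_cases h0 : q = 0
  · simp [h0]
  · exact iterate_derivative_eq_zero ((natDegree_lt_iff_degree_lt h0).2 hq)

lemma natDegree_legendre_le (n : ℕ) : (legendre n).natDegree ≤ n := by
  refine (natDegree_C_mul_le _ _).trans ((natDegree_iterate_derivative _ _).trans ?_)
  have : ((X ^ 2 - 1 : ℝ[X]) ^ n).natDegree ≤ n * 2 := by
    refine natDegree_pow_le_of_le n ?_
    compute_degree
  omega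

lemma card_roots_le_iterate_derivative (p : ℝ[X]) (k : ℕ) :
    Multiset.card p.roots ≤ Multiset.card (derivative^[k] p).roots + k := by
  induction k with
  | zero => simp
  | succ k ih =>
    rw [Function.iterate_succ_apply']
    have := card_roots_le_derivative (derivative^[k] p)
    omega

/-- By Rolle each derivative loses at most one real root counted with multiplicity; `n` derivatives
of a polynomial with `2n` roots leave at least `n`. -/
lemma card_roots_legendre (n : ℕ) : Multiset.card (legendre n).roots = n := by
  refine le_antisymm ((card_roots' _).trans (natDegree_legendre_le n)) ?_
  have h := card_roots_le_iterate_derivative ((X ^ 2 - 1 : ℝ[X]) ^ n) n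
  have hfac : (X ^ 2 - 1 : ℝ[X]) = (X - C 1) * (X - C (-1)) := by
    simp only [map_neg, map_one]; ring
  have h2 : Multiset.card ((X ^ 2 - 1 : ℝ[X]) ^ n).roots = 2 * n := by
    rw [roots_pow, hfac, roots_mul (mul_ne_zero (X_sub_C_ne_zero _) (X_sub_C_ne_zero _)),
      roots_X_sub_C, roots_X_sub_C]
    simp [mul_comm]
  rw [legendre, roots_C_mul _ (by positivity)]
  omega

lemma legendre_ne_zero (n : ℕ) : legendre n ≠ 0 := by
  intro h
  have := card_roots_legendre n
  rw [h] at this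
  obtain rfl : n = 0 := by simpa using this.symm
  simp [legendre] at h

lemma natDegree_legendre (n : ℕ) : (legendre n).natDegree = n :=
  le_antisymm (natDegree_legendre_le n) ((card_roots_legendre n).symm.le.trans (card_roots' _))

lemma degree_legendre (n : ℕ) : (legendre n).degree = n := by
  rw [degree_eq_natDegree (legendre_ne_zero n), natDegree_legendre]

/-- If `P_n = (X - a) ^ 2 q`, then `P_n q = ((X - a) q) ^ 2` has positive integral, against
orthogonality to `q`. -/
lemma nodup_roots_legendre (n : ℕ) : (legendre n).roots.Nodup := by
  classical
  rw [Multiset.nodup_iff_count_le_one]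
  intro a
  by_contra! hc
  rw [count_roots] at hc
  have hdvd : (X - C a) ^ 2 ∣ legendre n :=
    (le_rootMultiplicity_iff (legendre_ne_zero n)).1 hc
  obtain ⟨q, hq⟩ := hdvd
  have hq0 : q ≠ 0 := by rintro rfl; exact legendre_ne_zero n (by simpa using hq)
  have hdeg : q.degree < n := by
    have h1 := natDegree_legendre n
    rw [hq, natDegree_mul (pow_ne_zero _ (X_sub_C_ne_zero a)) hq0, natDegree_pow,
      natDegree_X_sub_C] at h1
    exact (natDegree_lt_iff_degree_lt hq0).1 (by omega)
  have h0 := polyIntegral_legendre_mul_eq_zero hdeg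
  have hpos : 0 < polyIntegral (legendre n * q) := by
    refine polyIntegral_pos (mul_ne_zero (legendre_ne_zero n) hq0) fun y _ => ?_
    rw [hq, show (X - C a) ^ 2 * q * q = ((X - C a) * q) ^ 2 by ring, eval_pow]
    positivity
  exact hpos.ne' h0

/-- If `P_n = (X - a) q` with `|a| ≥ 1`, then `P_n q = (X - a) q ^ 2` has constant sign on `[-1,
1]`, against orthogonality. -/
lemma abs_lt_one_of_mem_gaussNodes {n : ℕ} {a : ℝ} (ha : a ∈ gaussNodes n) : |a| < 1 := by
  have hroot : IsRoot (legendre n) a := by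
    rw [gaussNodes, Multiset.mem_toFinset] at ha
    exact isRoot_of_mem_roots ha
  obtain ⟨q, hq⟩ := dvd_iff_isRoot.2 hroot
  have hq0 : q ≠ 0 := by rintro rfl; exact legendre_ne_zero n (by simpa using hq)
  have hdeg : q.degree < n := by
    have h1 := natDegree_legendre n
    rw [hq, natDegree_mul (X_sub_C_ne_zero a) hq0, natDegree_X_sub_C] at h1
    exact (natDegree_lt_iff_degree_lt hq0).1 (by omega)
  have h0 := polyIntegral_legendre_mul_eq_zero hdeg
  have hev (y : ℝ) : (legendre n * q).eval y = (y - a) * (q.eval y) ^ 2 := by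
    rw [hq]; simp; ring
  by_contra! hc
  rcases le_abs.1 hc with h | h
  · have : 0 < polyIntegral (-(legendre n * q)) := by
      refine polyIntegral_pos (neg_ne_zero.2 (mul_ne_zero (legendre_ne_zero n) hq0)) fun y hy => ?_
      rw [eval_neg, hev, ← neg_mul]
      exact mul_nonneg (by linarith [hy.2]) (sq_nonneg _)
    rw [map_neg, h0] at this
    simp at this
  · have : 0 < polyIntegral (legendre n * q) := by
      refine polyIntegral_pos (mul_ne_zero (legendre_ne_zero n) hq0) fun y hy => ?_
      rw [hev]
      exact mul_nonneg (by linarith [hy.1]) (sq_nonneg _)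
    exact this.ne' h0

lemma card_gaussNodes (n : ℕ) : (gaussNodes n).card = n := by
  rw [gaussNodes, Multiset.toFinset_card_of_nodup (nodup_roots_legendre n), card_roots_legendre]

lemma eval_legendre_of_mem_gaussNodes {n : ℕ} {a : ℝ} (ha : a ∈ gaussNodes n) :
    (legendre n).eval a = 0 := by
  rw [gaussNodes, Multiset.mem_toFinset] at ha
  exact isRoot_of_mem_roots ha

lemma gaussWeight_eq (n : ℕ) (s : ℝ) :
    gaussWeight n s = polyIntegral (Lagrange.basis (gaussNodes n) id s) := rfl

/-- The Gauss-Legendre rule with `n` nodes is exact on polynomials of degree less than `2 n`. -/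
lemma sum_gaussWeight_mul_eval {n : ℕ} {p : ℝ[X]} (hp : p.degree < (2 * n : ℕ)) :
    ∑ s ∈ gaussNodes n, gaussWeight n s * p.eval s = polyIntegral p := by
  have hl := legendre_ne_zero n
  have hmod : (p % legendre n).degree < n := degree_legendre n ▸ degree_mod_lt p hl
  have hdiv : (p / legendre n).degree < n := by
    by_cases hlt : p.degree < (legendre n).degree
    · rw [(Polynomial.div_eq_zero_iff hl).2 hlt]; exact WithBot.bot_lt_coe n
    have h := degree_add_div hl (not_lt.1 hlt)
    by_cases h0 : p / legendre n = 0
    · rw [h0]; exact WithBot.bot_lt_coe n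
    have hp0 : p ≠ 0 := by rintro rfl; simp at h0
    rw [degree_legendre, degree_eq_natDegree h0, degree_eq_natDegree hp0] at h
    rw [degree_eq_natDegree hp0] at hp
    rw [degree_eq_natDegree h0]
    norm_cast at h hp ⊢
    omega
  -- The multiple of `P_n` drops out on both sides: by orthogonality in the integral, by vanishing
  -- at the nodes in the sum. The remainder equals its interpolant.
  have hp' : p = legendre n * (p / legendre n) + p % legendre n :=
    (EuclideanDomain.div_add_mod p (legendre n)).symm
  have hint := Lagrange.eq_interpolate (s := gaussNodes n) (v := id) (f := p % legendre n)
    Function.injective_id.injOn (by rwa [card_gaussNodes])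
  have heval : ∀ s ∈ gaussNodes n, p.eval s = (p % legendre n).eval s := fun s hs => by
    conv_lhs => rw [hp']
    simp [eval_legendre_of_mem_gaussNodes hs]
  conv_rhs => rw [hp', map_add, polyIntegral_legendre_mul_eq_zero hdiv, zero_add, hint,
    Lagrange.interpolate_apply, map_sum]
  refine Finset.sum_congr rfl fun s hs => ?_
  rw [← smul_eq_C_mul, map_smul, heval s hs, gaussWeight_eq, smul_eq_mul, mul_comm, id]

/-- The squared Lagrange basis polynomial has degree `2 (n - 1)`, so exactness identifies the weight
with the integral of a square. -/
lemma gaussWeight_nonneg {n : ℕ} {s : ℝ} (hs : s ∈ gaussNodes n) : 0 ≤ gaussWeight n s := by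
  have hinj : Set.InjOn (id : ℝ → ℝ) (gaussNodes n) := Function.injective_id.injOn
  have hn : 0 < n := by rw [← card_gaussNodes n]; exact Finset.card_pos.2 ⟨s, hs⟩
  have hb := Lagrange.natDegree_basis hinj hs
  rw [card_gaussNodes] at hb
  have h := sum_gaussWeight_mul_eval (n := n) (p := Lagrange.basis (gaussNodes n) id s ^ 2) (by
    refine (degree_le_natDegree).trans_lt ?_
    rw [natDegree_pow, hb]
    norm_cast
    omega)
  rw [Finset.sum_eq_single_of_mem s hs] at h
  · rw [eval_pow, show eval s (Lagrange.basis (gaussNodes n) id s) = 1 from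
      Lagrange.eval_basis_self hinj hs, one_pow, mul_one] at h
    rw [h]
    refine polyIntegral_nonneg fun y _ => ?_
    rw [eval_pow]
    positivity
  · intro t ht hts
    rw [eval_pow, show eval t (Lagrange.basis (gaussNodes n) id s) = 0 from
      Lagrange.eval_basis_of_ne (v := id) hts.symm ht]
    simp

/-- An inequality so as to cover the empty rule `n = 0`; otherwise equality holds by exactness on
`1`. -/
lemma sum_gaussWeight_le (n : ℕ) : ∑ s ∈ gaussNodes n, gaussWeight n s ≤ 2 := by
  rcases Nat.eq_zero_or_pos n with rfl | hn
  · rw [Finset.card_eq_zero.1 (card_gaussNodes 0)]; simp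
  · have h := sum_gaussWeight_mul_eval (n := n) (p := 1) (by
      rw [degree_one]; norm_cast; omega)
    simp only [eval_one, mul_one] at h
    rw [h, polyIntegral_apply]
    norm_num

lemma integral_ofReal_eval (p : ℝ[X]) :
    ∫ y in (-1 : ℝ)..1, ((p.eval y : ℝ) : ℂ) = (polyIntegral p : ℂ) := by
  rw [polyIntegral_apply]
  exact intervalIntegral.integral_ofReal

/-- The error of the Gauss-Legendre rule with `n` nodes is at most four times the uniform distance
to the complex polynomials of degree less than `2 n`. -/
lemma norm_integral_sub_sum_gaussWeight_le {n : ℕ} {f : ℝ → ℂ}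
    (hf : ContinuousOn f (Set.Icc (-1) 1)) {p : ℕ → ℝ[X]} (hp : ∀ k < 2 * n, (p k).degree ≤ k)
    {a : ℕ → ℂ} {ε : ℝ}
    (h : ∀ y ∈ Set.Icc (-1 : ℝ) 1,
      ‖f y - ∑ k ∈ Finset.range (2 * n), a k * (((p k).eval y : ℝ) : ℂ)‖ ≤ ε) :
    ‖(∫ y in (-1 : ℝ)..1, f y) - ∑ s ∈ gaussNodes n, (gaussWeight n s : ℂ) * f s‖ ≤ 4 * ε := by
  set P : ℝ → ℂ := fun y => ∑ k ∈ Finset.range (2 * n), a k * (((p k).eval y : ℝ) : ℂ) with hP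
  have hc (k : ℕ) : Continuous fun y : ℝ => (((p k).eval y : ℝ) : ℂ) :=
    Complex.continuous_ofReal.comp (p k).continuous
  have hPc : Continuous P := continuous_finsetSum _ fun k _ => continuous_const.mul (hc k)
  have hexact : ∫ y in (-1 : ℝ)..1, P y = ∑ s ∈ gaussNodes n, (gaussWeight n s : ℂ) * P s := by
    have hi : ∀ k ∈ Finset.range (2 * n), IntervalIntegrable
        (fun y => a k * (((p k).eval y : ℝ) : ℂ)) MeasureTheory.volume (-1) 1 := fun k _ =>
      (continuous_const.mul (hc k)).intervalIntegrable _ _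
    simp only [hP, intervalIntegral.integral_finsetSum hi, Finset.mul_sum]
    rw [Finset.sum_comm]
    refine Finset.sum_congr rfl fun k hk => ?_
    have hk' := Finset.mem_range.1 hk
    rw [intervalIntegral.integral_const_mul, integral_ofReal_eval,
      ← sum_gaussWeight_mul_eval (n := n) ((hp k hk').trans_lt (by exact_mod_cast hk')),
      Complex.ofReal_sum, Finset.mul_sum]
    refine Finset.sum_congr rfl fun s _ => ?_
    push_cast
    ring
  have hfi : IntervalIntegrable f MeasureTheory.volume (-1) 1 :=
    ContinuousOn.intervalIntegrable (by rwa [Set.uIcc_of_le (by norm_num)])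
  have hε : 0 ≤ ε := (norm_nonneg _).trans (h 0 (by norm_num))
  have h1 : ‖∫ y in (-1 : ℝ)..1, (f y - P y)‖ ≤ 2 * ε := by
    refine (intervalIntegral.norm_integral_le_of_norm_le_const (C := ε) fun y hy => ?_).trans ?_
    · rw [Set.uIoc_of_le (by norm_num)] at hy
      exact h y (Set.Ioc_subset_Icc_self hy)
    · norm_num; linarith
  have h2 : ‖∑ s ∈ gaussNodes n, (gaussWeight n s : ℂ) * (f s - P s)‖ ≤ 2 * ε := by
    refine (norm_sum_le _ _).trans ?_
    refine le_trans (Finset.sum_le_sum (g := fun s => gaussWeight n s * ε) fun s hs => ?_) ?_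
    · rw [norm_mul, Complex.norm_real, Real.norm_of_nonneg (gaussWeight_nonneg hs)]
      have := abs_lt.1 (abs_lt_one_of_mem_gaussNodes hs)
      exact mul_le_mul_of_nonneg_left (h s ⟨this.1.le, this.2.le⟩) (gaussWeight_nonneg hs)
    · rw [← Finset.sum_mul]
      exact mul_le_mul_of_nonneg_right (sum_gaussWeight_le n) hε
  have h3 : (∫ y in (-1 : ℝ)..1, f y) - ∑ s ∈ gaussNodes n, (gaussWeight n s : ℂ) * f s
      = (∫ y in (-1 : ℝ)..1, (f y - P y))
        - ∑ s ∈ gaussNodes n, (gaussWeight n s : ℂ) * (f s - P s) := by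
    rw [intervalIntegral.integral_sub hfi (hPc.intervalIntegrable _ _), hexact]
    simp only [mul_sub, Finset.sum_sub_distrib]
    ring
  rw [h3]
  refine (norm_sub_le _ _).trans ?_
  linarith

end ParabolicQuadrature

end
noncomputable section

/-! ### Chebyshev approximation on Bernstein ellipses -/

namespace ParabolicQuadrature

open Real Set

/-- The Joukowsky map. -/
def joukowsky (w : ℂ) : ℂ := (w + w⁻¹) / 2

lemma differentiableAt_joukowsky {w : ℂ} (hw : w ≠ 0) : DifferentiableAt ℂ joukowsky w := by
  unfold joukowsky
  fun_prop (disch := assumption)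

lemma norm_joukowsky_circleIntegral_le {g : ℂ → ℂ} {M r : ℝ} (hr : 0 < r)
    (hM : ∀ w : ℂ, ‖w‖ = r → ‖g (joukowsky w)‖ ≤ M) (n : ℤ) :
    ‖(2 * π * Complex.I : ℂ)⁻¹ * ∮ w in C(0, r), w ^ (-n - 1) * g (joukowsky w)‖ ≤ M * r ^ (-n) := by
  have h := circleIntegral.norm_integral_le_of_norm_le_const (c := 0) (R := r)
    (f := fun w => w ^ (-n - 1) * g (joukowsky w)) (C := r ^ (-n - 1) * M) hr.le (fun w hw => by
      have hw' : ‖w‖ = r := by simpa using hw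
      rw [norm_mul, norm_zpow, hw']
      exact mul_le_mul_of_nonneg_left (hM w hw') (zpow_nonneg hr.le _))
  rw [norm_mul, norm_inv]
  have hpi : ‖(2 * π * Complex.I : ℂ)‖ = 2 * π := by
    simp [abs_of_pos pi_pos]
  rw [hpi, inv_mul_le_iff₀ (by positivity)]
  refine h.trans (le_of_eq ?_)
  rw [zpow_sub_one₀ hr.ne']
  field_simp

lemma circleIntegral_joukowsky_eq {g : ℂ → ℂ} {ρ r₁ r₂ : ℝ} (hρ : 1 < ρ)
    (hd : ∀ w : ℂ, ρ⁻¹ ≤ ‖w‖ → ‖w‖ ≤ ρ → DifferentiableAt ℂ g (joukowsky w)) (n : ℤ)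
    (h₁ : ρ⁻¹ ≤ r₁) (h₁₂ : r₁ ≤ r₂) (h₂ : r₂ ≤ ρ) :
    (∮ w in C(0, r₂), w ^ (-n - 1) * g (joukowsky w)) =
      ∮ w in C(0, r₁), w ^ (-n - 1) * g (joukowsky w) := by
  have hr₁ : 0 < r₁ := (by positivity : 0 < ρ⁻¹).trans_le h₁
  have key (w : ℂ) (hw : r₁ ≤ ‖w‖) (hw' : ‖w‖ ≤ r₂) :
      DifferentiableAt ℂ (fun w => w ^ (-n - 1) * g (joukowsky w)) w := by
    have hw0 : w ≠ 0 := norm_pos_iff.1 (hr₁.trans_le hw)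
    exact (differentiableAt_zpow.2 (Or.inl hw0)).mul
      ((hd w (h₁.trans hw) (hw'.trans h₂)).comp w (differentiableAt_joukowsky hw0))
  refine Complex.circleIntegral_eq_of_differentiable_on_annulus_off_countable hr₁ h₁₂
    countable_empty (fun w hw => ?_) (fun w hw => ?_)
  · simp only [mem_sdiff, Metric.mem_closedBall, Metric.mem_ball, dist_zero_right, not_lt] at hw
    exact (key w hw.2 hw.1).continuousAt.continuousWithinAt
  · simp only [mem_sdiff, Metric.mem_closedBall, Metric.mem_ball, dist_zero_right, not_le] at hw
    exact key w hw.1.2.le hw.1.1.le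

instance : Fact (0 < 2 * π) := ⟨by positivity⟩

lemma fourierCoeff_joukowsky (g : ℂ → ℂ) (n : ℤ) :
    fourierCoeff (fun y : AddCircle (2 * π) => g (joukowsky (AddCircle.toCircle y : ℂ))) n =
      (2 * π * Complex.I : ℂ)⁻¹ * ∮ w in C(0, 1), w ^ (-n - 1) * g (joukowsky w) := by
  rw [fourierCoeff_eq_intervalIntegral _ n 0, circleIntegral, zero_add,
    ← intervalIntegral.integral_const_mul, ← intervalIntegral.integral_smul]
  refine intervalIntegral.integral_congr fun θ _ => ?_
  have h1 : (AddCircle.toCircle (T := 2 * π) (θ : AddCircle (2 * π)) : ℂ)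
      = Complex.exp (θ * Complex.I) := by
    rw [AddCircle.toCircle_apply_mk, Circle.coe_exp, div_self (by positivity), one_mul]
  have h2 : circleMap 0 1 θ = Complex.exp (θ * Complex.I) := by simp [circleMap]
  have h3 : fourier (-n) (θ : AddCircle (2 * π)) = Complex.exp (θ * Complex.I) ^ (-n) := by
    rw [fourier_coe_apply, ← Complex.exp_int_mul]
    congr 1
    push_cast
    have : (π : ℂ) ≠ 0 := by exact_mod_cast pi_ne_zero
    field_simp
  simp only [h1, h3, deriv_circleMap, h2, smul_eq_mul, Complex.real_smul]
  rw [zpow_sub_one₀ (Complex.exp_ne_zero _)]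
  have : (π : ℂ) ≠ 0 := by exact_mod_cast pi_ne_zero
  have := Complex.I_ne_zero
  have := Complex.exp_ne_zero (θ * Complex.I)
  push_cast
  field_simp

/-- The coefficient is a Laurent coefficient of `g ∘ joukowsky`; its contour moves from the unit
circle to `|w| = ρ` for `n ≥ 0` and to `|w| = ρ⁻¹` for `n ≤ 0`. -/
lemma norm_fourierCoeff_joukowsky_le {g : ℂ → ℂ} {M ρ : ℝ} (hρ : 1 < ρ)
    (hd : ∀ w : ℂ, ρ⁻¹ ≤ ‖w‖ → ‖w‖ ≤ ρ → DifferentiableAt ℂ g (joukowsky w))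
    (hM : ∀ w : ℂ, ρ⁻¹ ≤ ‖w‖ → ‖w‖ ≤ ρ → ‖g (joukowsky w)‖ ≤ M) (n : ℤ) :
    ‖fourierCoeff (fun y : AddCircle (2 * π) => g (joukowsky (AddCircle.toCircle y : ℂ))) n‖ ≤
      M * ρ⁻¹ ^ n.natAbs := by
  have hρ0 : 0 < ρ := one_pos.trans hρ
  have hinv : ρ⁻¹ < 1 := inv_lt_one_of_one_lt₀ hρ
  rw [fourierCoeff_joukowsky]
  rcases le_total 0 n with hn | hn
  · rw [← circleIntegral_joukowsky_eq hρ hd n hinv.le hρ.le le_rfl]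
    refine (norm_joukowsky_circleIntegral_le hρ0
      (fun w hw => hM w (by rw [hw]; exact (hinv.trans hρ).le) hw.le) n).trans (le_of_eq ?_)
    lift n to ℕ using hn
    simp
  · rw [circleIntegral_joukowsky_eq hρ hd n le_rfl hinv.le hρ.le]
    refine (norm_joukowsky_circleIntegral_le (inv_pos.2 hρ0)
      (fun w hw => hM w hw.ge (by rw [hw]; exact (hinv.trans hρ).le)) n).trans (le_of_eq ?_)
    obtain ⟨m, rfl⟩ := Int.eq_ofNat_of_zero_le (neg_nonneg.2 hn) |>.imp fun m hm => neg_eq_iff_eq_neg.1 hm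
    simp

/-- A function that is analytic and bounded by `M` on the Bernstein ellipse with parameter `ρ` is
uniformly approximated on `[-1, 1]` by truncated Chebyshev series. -/
lemma exists_chebyshev_approx {g : ℂ → ℂ} {M ρ : ℝ} (hρ : 1 < ρ)
    (hd : ∀ w : ℂ, ρ⁻¹ ≤ ‖w‖ → ‖w‖ ≤ ρ → DifferentiableAt ℂ g (joukowsky w))
    (hM : ∀ w : ℂ, ρ⁻¹ ≤ ‖w‖ → ‖w‖ ≤ ρ → ‖g (joukowsky w)‖ ≤ M) :
    ∃ a : ℕ → ℂ, ∀ N : ℕ, ∀ s ∈ Icc (-1 : ℝ) 1,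
      ‖g s - ∑ k ∈ Finset.range N, a k * (((Polynomial.Chebyshev.T ℝ k).eval s : ℝ) : ℂ)‖ ≤
        2 * M * ρ⁻¹ ^ N / (1 - ρ⁻¹) := by
  have hρ0 : 0 < ρ := one_pos.trans hρ
  have hinv : ρ⁻¹ < 1 := inv_lt_one_of_one_lt₀ hρ
  have hM0 : 0 ≤ M := (norm_nonneg _).trans (hM 1 (by simpa using hinv.le) (by simpa using hρ.le))
  set c : ℤ → ℂ := fourierCoeff
    (fun y : AddCircle (2 * π) => g (joukowsky (AddCircle.toCircle y : ℂ))) with hc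
  have hcb (n : ℤ) : ‖c n‖ ≤ M * ρ⁻¹ ^ n.natAbs := norm_fourierCoeff_joukowsky_le hρ hd hM n
  have hgeo : Summable fun n : ℕ => M * ρ⁻¹ ^ n :=
    (summable_geometric_of_lt_one (by positivity) hinv).mul_left M
  have hsum : Summable c := by
    refine Summable.of_nat_of_neg ?_ ?_ <;>
    · refine hgeo.of_norm_bounded fun n => (hcb _).trans (le_of_eq ?_)
      simp
  let F : C(AddCircle (2 * π), ℂ) := ⟨fun y => g (joukowsky (AddCircle.toCircle y : ℂ)), by
    rw [continuous_iff_continuousAt]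
    intro y
    have hn : ‖(AddCircle.toCircle y : ℂ)‖ = 1 := Circle.norm_coe _
    have h1 := (hd _ (by rw [hn]; exact hinv.le) (by rw [hn]; exact hρ.le)).continuousAt
    have h2 := (differentiableAt_joukowsky (w := (AddCircle.toCircle y : ℂ))
      (norm_pos_iff.1 (by rw [hn]; exact one_pos))).continuousAt
    have h3 : Continuous fun y : AddCircle (2 * π) => (AddCircle.toCircle y : ℂ) :=
      continuous_subtype_val.comp AddCircle.continuous_toCircle
    exact ContinuousAt.comp (f := fun y : AddCircle (2 * π) => joukowsky (AddCircle.toCircle y : ℂ))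
      h1 (ContinuousAt.comp (f := fun y : AddCircle (2 * π) => (AddCircle.toCircle y : ℂ))
        h2 h3.continuousAt)⟩
  -- Folding `n` with `-n` counts `c 0` twice, hence the correction at `n = 0`.
  refine ⟨fun n => c n + c (-n) - if n = 0 then c 0 else 0, fun N s hs => ?_⟩
  set θ := Real.arccos s
  have hcos : Real.cos θ = s := Real.cos_arccos hs.1 hs.2
  have hF (x : ℝ) (hx : Real.cos x = s) : F (x : AddCircle (2 * π)) = g s := by
    change g (joukowsky _) = _
    rw [AddCircle.toCircle_apply_mk, Circle.coe_exp, div_self (by positivity), one_mul, joukowsky,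
      ← Complex.exp_neg, ← hx, Complex.ofReal_cos, Complex.cos, neg_mul]
  have hfs (x : ℝ) (hx : Real.cos x = s) :
      HasSum (fun n : ℤ => c n * Complex.exp (n * x * Complex.I)) (g s) := by
    have := has_pointwise_sum_fourier_series_of_summable (f := F) hsum (x : AddCircle (2 * π))
    rw [hF x hx] at this
    convert this using 2 with n
    rw [fourier_coe_apply, smul_eq_mul]
    have : (π : ℂ) ≠ 0 := by exact_mod_cast pi_ne_zero
    congr 2
    push_cast
    field_simp
  -- Averaging the Fourier series at `θ` and `-θ`, both sent to `s`, turns exponentials into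
  -- cosines, that is, into `T_n(s)`.
  have hZ : HasSum (fun n : ℤ => c n * (((Real.cos (n * θ) : ℝ)) : ℂ)) (g s) := by
    have := ((hfs θ hcos).add (hfs (-θ) (by rw [Real.cos_neg, hcos]))).div_const 2
    rw [add_self_div_two] at this
    refine this.congr_fun fun n => ?_
    rw [Complex.ofReal_cos, Complex.cos]
    push_cast
    ring_nf
  have hN : HasSum (fun n : ℕ => (c n + c (-n) - if n = 0 then c 0 else 0)
      * (((Polynomial.Chebyshev.T ℝ n).eval s : ℝ) : ℂ)) (g s) := by
    have h1 := hZ.nat_add_neg.sub (hasSum_ite_eq (0 : ℕ) (c 0))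
    simp only [Int.cast_zero, zero_mul, Real.cos_zero, Complex.ofReal_one, mul_one,
      add_sub_cancel_right] at h1
    refine h1.congr_fun fun n => ?_
    rw [← hcos, Polynomial.Chebyshev.T_real_cos]
    by_cases hn : n = 0
    · simp [hn]
    · simp [hn]; ring
  rw [norm_sub_rev]
  refine norm_sub_le_of_geometric_bound_of_hasSum (C := 2 * M) hinv (fun n => ?_) hN N
  have hT : ‖(((Polynomial.Chebyshev.T ℝ n).eval s : ℝ) : ℂ)‖ ≤ 1 := by
    rw [Complex.norm_real]
    exact Polynomial.Chebyshev.abs_eval_T_real_le_one n (abs_le.2 hs)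
  rw [norm_mul]
  refine (mul_le_of_le_one_right (norm_nonneg _) hT).trans ?_
  by_cases hn : n = 0
  · have := hcb 0
    simp only [hn]
    simp at this ⊢
    linarith
  · have h1 := hcb n
    have h2 := hcb (-n)
    simp only [hn, if_false, sub_zero]
    simp only [Int.natAbs_neg, Int.natAbs_natCast] at h1 h2
    refine (norm_add_le _ _).trans ?_
    linarith

/-- The geometric convergence of Gauss-Legendre quadrature for functions that are analytic on a
Bernstein ellipse. -/
theorem norm_integral_sub_gauss_le {g : ℂ → ℂ} {M ρ : ℝ} (hρ : 1 < ρ)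
    (hd : ∀ w : ℂ, ρ⁻¹ ≤ ‖w‖ → ‖w‖ ≤ ρ → DifferentiableAt ℂ g (joukowsky w))
    (hM : ∀ w : ℂ, ρ⁻¹ ≤ ‖w‖ → ‖w‖ ≤ ρ → ‖g (joukowsky w)‖ ≤ M)
    (hc : ContinuousOn (fun y : ℝ => g y) (Icc (-1) 1)) (J : ℕ) :
    ‖(∫ y in (-1 : ℝ)..1, g y) - ∑ s ∈ gaussNodes J, (gaussWeight J s : ℂ) * g s‖ ≤
      8 * M * ρ⁻¹ ^ (2 * J) / (1 - ρ⁻¹) := by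
  obtain ⟨a, ha⟩ := exists_chebyshev_approx hρ hd hM
  refine (norm_integral_sub_sum_gaussWeight_le hc (p := fun k => Polynomial.Chebyshev.T ℝ k)
    (fun k _ => ?_) (ha (2 * J))).trans (le_of_eq (by ring))
  rw [Polynomial.Chebyshev.degree_T]
  simp

end ParabolicQuadrature

end
noncomputable section

/-! ### The Cauchy integral along the parabola and its truncation -/

namespace ParabolicQuadrature

open Real Set

/-- The parabola `t ^ 2 - q + i t`. -/
def parabola (q t : ℝ) : ℂ := (t : ℂ) ^ 2 - (q : ℂ) + Complex.I * (t : ℂ)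

@[simp] lemma parabola_re (q t : ℝ) : (parabola q t).re = t ^ 2 - q := by
  simp [parabola, ← Complex.ofReal_pow]

@[simp] lemma parabola_im (q t : ℝ) : (parabola q t).im = t := by
  simp [parabola, ← Complex.ofReal_pow]

lemma hasDerivAt_parabola (q t : ℝ) : HasDerivAt (parabola q) (2 * t + Complex.I) t := by
  have h : HasDerivAt (fun z : ℂ => z ^ 2 - (q : ℂ) + Complex.I * z) (2 * t + Complex.I) (t : ℂ) := by
    have := (((hasDerivAt_id (t : ℂ)).pow 2).sub_const (q : ℂ)).add
      ((hasDerivAt_id (t : ℂ)).const_mul Complex.I)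
    exact this.congr_deriv (by simp)
  exact h.comp_ofReal

lemma neg_parabola_mem_slitPlane {q : ℝ} (hq : 0 < q) (t : ℝ) :
    -parabola q t ∈ Complex.slitPlane := by
  rw [Complex.mem_slitPlane_iff]
  by_cases ht : t = 0
  · left; simp [ht, hq]
  · right; simpa using ht

lemma parabola_ne_zero {q : ℝ} (hq : 0 < q) (t : ℝ) : parabola q t ≠ 0 :=
  neg_ne_zero.1 (Complex.slitPlane_ne_zero (neg_parabola_mem_slitPlane hq t))

/-- The integrand of the Cauchy integral along the parabola. -/
def cauchyIntegrand (β q t : ℝ) : ℂ :=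
  Complex.exp (-(β : ℂ) * parabola q t) * (2 * t + Complex.I) / parabola q t

lemma continuous_parabola (q : ℝ) : Continuous (parabola q) :=
  continuous_iff_continuousAt.2 fun t => (hasDerivAt_parabola q t).continuousAt

lemma continuous_cauchyIntegrand (β : ℝ) {q : ℝ} (hq : 0 < q) :
    Continuous (cauchyIntegrand β q) := by
  have := continuous_parabola q
  unfold cauchyIntegrand
  exact Continuous.div (by fun_prop) this (parabola_ne_zero hq)

/-- The singularity at `0` is removable. This isolates the residue of `e^{-βw}/w` in the term `1/w`,
which a logarithm handles. -/
lemma exists_primitive_exp_sub_one_div (β R : ℝ) : ∃ Ψ : ℂ → ℂ, ∀ w ∈ Metric.ball (0 : ℂ) R,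
    w ≠ 0 → HasDerivAt Ψ ((Complex.exp (-(β : ℂ) * w) - 1) / w) w := by
  have hd : DifferentiableOn ℂ (dslope (fun w : ℂ => Complex.exp (-(β : ℂ) * w)) 0)
      (Metric.ball (0 : ℂ) R) := by
    have : DifferentiableOn ℂ (dslope (fun w : ℂ => Complex.exp (-(β : ℂ) * w)) 0) univ :=
      (Complex.differentiableOn_dslope Filter.univ_mem).2 (by fun_prop)
    exact this.mono (subset_univ _)
  obtain ⟨Ψ, hΨ⟩ := hd.isExactOn_ball
  refine ⟨Ψ, fun w hw h0 => ?_⟩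
  have := hΨ w hw
  rw [dslope_of_ne _ h0, slope_def_field] at this
  simpa using this

lemma log_neg_sub_log_of_im_pos {w : ℂ} (hw : 0 < w.im) :
    Complex.log (-w) - Complex.log w = -(π * Complex.I) := by
  rw [Complex.log, Complex.log, norm_neg, Complex.arg_neg_eq_arg_sub_pi_of_im_pos hw]
  push_cast
  ring

lemma log_neg_sub_log_of_im_neg {w : ℂ} (hw : w.im < 0) :
    Complex.log (-w) - Complex.log w = π * Complex.I := by
  rw [Complex.log, Complex.log, norm_neg, Complex.arg_neg_eq_arg_add_pi_of_im_neg hw]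
  push_cast
  ring

lemma norm_exp_neg_mul (β : ℝ) (w : ℂ) :
    ‖Complex.exp (-(β : ℂ) * w)‖ = Real.exp (-β * w.re) := by
  rw [Complex.norm_exp]
  simp

/-- Cauchy's formula for the truncated parabola, closed by a vertical segment. -/
lemma norm_integral_cauchyIntegrand_add_le (β : ℝ) {q N : ℝ} (hq : 0 < q) (hN : 0 < N)
    (hqN : q < N ^ 2) :
    ‖(∫ t in (-N)..N, cauchyIntegrand β q t) + 2 * π * Complex.I‖ ≤
      Real.exp (-β * (N ^ 2 - q)) / (N ^ 2 - q) * (2 * N) := by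
  obtain ⟨R, hR⟩ : ∃ R, ∀ t ∈ Icc (-N) N, parabola q t ∈ Metric.ball (0 : ℂ) R := by
    obtain ⟨C, hC⟩ := isCompact_Icc.exists_bound_of_continuousOn
      (continuous_parabola q).continuousOn (s := Icc (-N) N)
    exact ⟨C + 1, fun t ht => by simpa using (hC t ht).trans_lt (lt_add_one C)⟩
  obtain ⟨Ψ, hΨ⟩ := exists_primitive_exp_sub_one_div β R
  -- On the parabola, which avoids `[0, ∞)`, the primitive of `1/w` is `log (-w)`; on the closing
  -- segment, where `Re w > 0`, it is `log w`. Their mismatch at the two ends produces `2πi`.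
  have hint : ∫ t in (-N)..N, cauchyIntegrand β q t =
      (Complex.log (-parabola q N) + Ψ (parabola q N)) -
        (Complex.log (-parabola q (-N)) + Ψ (parabola q (-N))) := by
    refine intervalIntegral.integral_eq_sub_of_hasDerivAt
      (f := fun t => Complex.log (-parabola q t) + Ψ (parabola q t)) (fun t ht => ?_)
      ((continuous_cauchyIntegrand β hq).intervalIntegrable _ _)
    rw [uIcc_of_le (by linarith)] at ht
    have hp := hasDerivAt_parabola q t
    have h0 := parabola_ne_zero hq t
    have h1 := hp.neg.clog_real (neg_parabola_mem_slitPlane hq t)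
    have h2 := (hΨ _ (hR t ht) h0).comp t hp
    refine (h1.add h2).congr_deriv ?_
    rw [cauchyIntegrand]
    simp only [Pi.neg_apply]
    field_simp
    ring
  have hA : 0 < N ^ 2 - q := sub_pos.2 hqN
  have hre : ∀ w ∈ segment ℝ (parabola q (-N)) (parabola q N), w.re = N ^ 2 - q := by
    rintro w ⟨u, v, _, _, huv, rfl⟩
    simp only [Complex.add_re, Complex.real_smul, Complex.re_ofReal_mul, parabola_re]
    linear_combination (N ^ 2 - q) * huv
  have hseg : ‖(Complex.log (parabola q N) + Ψ (parabola q N)) -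
      (Complex.log (parabola q (-N)) + Ψ (parabola q (-N)))‖ ≤
        Real.exp (-β * (N ^ 2 - q)) / (N ^ 2 - q) * ‖parabola q N - parabola q (-N)‖ := by
    refine Convex.norm_image_sub_le_of_norm_hasDerivWithin_le
      (f := fun w => Complex.log w + Ψ w) (f' := fun w => Complex.exp (-(β : ℂ) * w) / w)
      (s := segment ℝ (parabola q (-N)) (parabola q N)) (fun w hw => ?_) (fun w hw => ?_)
      (convex_segment _ _) (left_mem_segment _ _ _) (right_mem_segment _ _ _)
    · have hw' := hre w hw
      have hslit : w ∈ Complex.slitPlane := Complex.mem_slitPlane_iff.2 (Or.inl (hw' ▸ hA))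
      have h0 := Complex.slitPlane_ne_zero hslit
      have hb : w ∈ Metric.ball (0 : ℂ) R := (convex_ball (0 : ℂ) R).segment_subset
        (hR _ ⟨le_rfl, by linarith⟩) (hR _ ⟨by linarith, le_rfl⟩) hw
      refine (((Complex.hasDerivAt_log hslit).add (hΨ w hb h0)).congr_deriv ?_).hasDerivWithinAt
      field_simp
      ring
    · rw [norm_div, norm_exp_neg_mul, hre w hw]
      refine div_le_div_of_nonneg_left (Real.exp_pos _).le hA ?_
      rw [← hre w hw]
      exact (le_abs_self _).trans (Complex.abs_re_le_norm w)
  have hdiff : ‖parabola q N - parabola q (-N)‖ = 2 * N := by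
    have : parabola q N - parabola q (-N) = ((2 * N : ℝ) : ℂ) * Complex.I := by
      simp only [parabola]; push_cast; ring
    rw [this, norm_mul, Complex.norm_I, mul_one, Complex.norm_real, norm_of_nonneg (by positivity)]
  rw [hdiff] at hseg
  refine le_of_eq_of_le ?_ hseg
  congr 1
  rw [hint]
  have h1 := log_neg_sub_log_of_im_pos (w := parabola q N) (by simpa)
  have h2 := log_neg_sub_log_of_im_neg (w := parabola q (-N)) (by simpa)
  linear_combination h1 - h2

/-- For `t ≥ T ≥ 0` one has `t ^ 2 ≥ T ^ 2 + (t - T) ^ 2`, which leaves a half-line Gaussian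
integral. -/
lemma integral_exp_neg_mul_sq_le {β T N : ℝ} (hβ : 0 < β) (hT : 0 ≤ T) (hTN : T ≤ N) :
    ∫ t in T..N, Real.exp (-β * t ^ 2) ≤ Real.exp (-β * T ^ 2) * (√(π / β) / 2) := by
  have h1 : ∫ t in T..N, Real.exp (-β * t ^ 2) ≤
      ∫ t in T..N, Real.exp (-β * T ^ 2) * Real.exp (-β * (t - T) ^ 2) := by
    refine intervalIntegral.integral_mono_on hTN
      (Continuous.intervalIntegrable (by fun_prop) _ _)
      (Continuous.intervalIntegrable (by fun_prop) _ _) fun t ht => ?_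
    rw [← Real.exp_add, Real.exp_le_exp]
    nlinarith [mul_nonneg hβ.le (mul_nonneg hT (sub_nonneg.2 ht.1))]
  refine h1.trans ?_
  rw [intervalIntegral.integral_const_mul, intervalIntegral.integral_comp_sub_right
    (fun t => Real.exp (-β * t ^ 2)), sub_self]
  refine mul_le_mul_of_nonneg_left ?_ (Real.exp_pos _).le
  rw [← integral_gaussian_Ioi, intervalIntegral.integral_of_le (sub_nonneg.2 hTN)]
  exact MeasureTheory.setIntegral_mono_set (integrable_exp_neg_mul_sq hβ).integrableOn
    (Filter.Eventually.of_forall fun t => (Real.exp_pos _).le)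
    (Filter.Eventually.of_forall fun t ht => ht.1)

/-- For `|t| ≥ 1`, `|2t + i| = √(4t² + 1) ≤ √5 |t|`, while the denominator is at least its imaginary
part `|t|`. -/
lemma norm_cauchyIntegrand_le (β q : ℝ) {t : ℝ} (ht : 1 ≤ |t|) :
    ‖cauchyIntegrand β q t‖ ≤ √5 * Real.exp (β * q) * Real.exp (-β * t ^ 2) := by
  have h1 : |t| ≤ ‖parabola q t‖ := by
    simpa using Complex.abs_im_le_norm (parabola q t)
  have h2 : ‖(2 * t + Complex.I : ℂ)‖ ≤ √5 * |t| := by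
    have : (2 * t + Complex.I : ℂ) = ((2 * t : ℝ) : ℂ) + ((1 : ℝ) : ℂ) * Complex.I := by simp
    rw [this, Complex.norm_add_mul_I, ← Real.sqrt_sq_eq_abs, ← Real.sqrt_mul (by norm_num)]
    refine Real.sqrt_le_sqrt ?_
    have : 1 ≤ t ^ 2 := by rw [← sq_abs]; nlinarith
    linarith
  rw [cauchyIntegrand, norm_div, norm_mul, norm_exp_neg_mul, parabola_re,
    div_le_iff₀ (by linarith), mul_assoc (√5), ← Real.exp_add,
    show β * q + -β * t ^ 2 = -β * (t ^ 2 - q) by ring]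
  calc _ ≤ Real.exp (-β * (t ^ 2 - q)) * (√5 * |t|) := by gcongr
    _ = √5 * Real.exp (-β * (t ^ 2 - q)) * |t| := by ring
    _ ≤ _ := by gcongr

lemma norm_integral_cauchyIntegrand_tail_le {β q T N : ℝ} (hβ : 0 < β) (hT : 1 ≤ T)
    (hTN : T ≤ N) {σ : ℝ} (hσ : |σ| = 1) :
    ‖∫ t in T..N, cauchyIntegrand β q (σ * t)‖ ≤
      √5 * Real.exp (β * q) * (Real.exp (-β * T ^ 2) * (√(π / β) / 2)) := by
  have h := intervalIntegral.norm_integral_le_of_norm_le hTN (μ := MeasureTheory.volume)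
    (f := fun t => cauchyIntegrand β q (σ * t))
    (g := fun t => √5 * Real.exp (β * q) * Real.exp (-β * t ^ 2))
    (Filter.Eventually.of_forall fun t ht => by
      have := norm_cauchyIntegrand_le β q (t := σ * t) (by
        rw [abs_mul, hσ, one_mul, abs_of_pos (by linarith [ht.1])]; linarith [ht.1])
      rwa [mul_pow, ← sq_abs σ, hσ, one_pow, one_mul] at this)
    (Continuous.intervalIntegrable (by fun_prop) _ _)
  refine h.trans ?_
  rw [intervalIntegral.integral_const_mul]
  exact mul_le_mul_of_nonneg_left (integral_exp_neg_mul_sq_le hβ (by linarith) hTN) (by positivity)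

/-- The error of truncating the Cauchy integral along the parabola to `[-T, T]`. -/
theorem norm_integral_cauchyIntegrand_add_two_pi_I_le {β q T : ℝ} (hβ : 0 < β) (hq : 0 < q)
    (hT : 1 ≤ T) :
    ‖(∫ t in (-T)..T, cauchyIntegrand β q t) + 2 * π * Complex.I‖ ≤
      √5 * Real.exp (β * q) * (Real.exp (-β * T ^ 2) * √(π / β)) := by
  set C := √5 * Real.exp (β * q) * (Real.exp (-β * T ^ 2) * √(π / β)) with hC
  have hlim : Filter.Tendsto (fun N : ℝ => 4 / N + C) Filter.atTop (nhds (0 + C)) :=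
    (Filter.Tendsto.const_div_atTop Filter.tendsto_id 4).add_const C
  rw [zero_add] at hlim
  refine ge_of_tendsto hlim ?_
  -- `N ≥ 2q` and `N ≥ 1` give `q ≤ N ^ 2 / 2`, so the closing segment costs at most `4 / N`.
  filter_upwards [Filter.eventually_ge_atTop (max T (2 * q))] with N hN
  have hTN : T ≤ N := (le_max_left _ _).trans hN
  have hqN : 2 * q ≤ N := (le_max_right _ _).trans hN
  have hN1 : 1 ≤ N := hT.trans hTN
  have hA : N ^ 2 / 2 ≤ N ^ 2 - q := by nlinarith
  have hA' : 0 < N ^ 2 / 2 := by positivity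
  have h1 := norm_integral_cauchyIntegrand_add_le β hq (by linarith : 0 < N) (by linarith)
  have h2 : Real.exp (-β * (N ^ 2 - q)) / (N ^ 2 - q) * (2 * N) ≤ 4 / N := by
    calc _ ≤ 1 / (N ^ 2 / 2) * (2 * N) := by
          gcongr
          rw [Real.exp_le_one_iff]
          nlinarith
      _ = 4 / N := by field_simp; norm_num
  have hi (a b : ℝ) : IntervalIntegrable (cauchyIntegrand β q) MeasureTheory.volume a b :=
    (continuous_cauchyIntegrand β hq).intervalIntegrable _ _
  have h3 := norm_integral_cauchyIntegrand_tail_le (q := q) hβ hT hTN (σ := 1) (by norm_num)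
  have h4 := norm_integral_cauchyIntegrand_tail_le (q := q) hβ hT hTN (σ := -1) (by norm_num)
  simp only [one_mul, neg_mul, intervalIntegral.integral_comp_neg] at h3 h4
  have h5 := intervalIntegral.integral_add_adjacent_intervals (hi (-N) (-T)) (hi (-T) T)
  have h6 := intervalIntegral.integral_add_adjacent_intervals (hi (-N) T) (hi T N)
  have h7 : (∫ t in (-T)..T, cauchyIntegrand β q t) + 2 * π * Complex.I =
      ((∫ t in (-N)..N, cauchyIntegrand β q t) + 2 * π * Complex.I)
        - (∫ t in (-N)..(-T), cauchyIntegrand β q t) - ∫ t in T..N, cauchyIntegrand β q t := by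
    linear_combination h5 + h6
  rw [h7]
  refine (norm_sub_le _ _).trans ((add_le_add_left (norm_sub_le _ _) _).trans ?_)
  have hC' : C = √5 * Real.exp (β * q) * (Real.exp (-(β * T ^ 2)) * (√(π / β) / 2)) +
      √5 * Real.exp (β * q) * (Real.exp (-(β * T ^ 2)) * (√(π / β) / 2)) := by
    rw [hC, neg_mul]; ring
  linarith

end ParabolicQuadrature

end
noncomputable section

/-! ### Quadrature error of the Cauchy integrand in a strip -/

namespace ParabolicQuadrature

open Real Set

lemma abs_im_joukowsky_le {ρ : ℝ} (hρ : 1 < ρ) {w : ℂ} (h₁ : ρ⁻¹ ≤ ‖w‖) (h₂ : ‖w‖ ≤ ρ) :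
    |(joukowsky w).im| ≤ (ρ - ρ⁻¹) / 2 := by
  have hρ0 : 0 < ρ := one_pos.trans hρ
  have hw : 0 < ‖w‖ := (inv_pos.2 hρ0).trans_le h₁
  have h₃ : ‖w‖⁻¹ ≤ ρ := inv_le_of_inv_le₀ hρ0 h₁
  have h₄ : ρ⁻¹ ≤ ‖w‖⁻¹ := inv_anti₀ hw h₂
  have him : (joukowsky w).im = (w.im / ‖w‖) * ((‖w‖ - ‖w‖⁻¹) / 2) := by
    rw [joukowsky, Complex.div_ofNat_im, Complex.add_im, Complex.inv_im, Complex.normSq_eq_norm_sq]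
    field_simp
    ring
  have h5 : |w.im / ‖w‖| ≤ 1 := by
    rw [abs_div, abs_norm, div_le_one hw]
    exact Complex.abs_im_le_norm w
  rw [him, abs_mul]
  refine (mul_le_of_le_one_left (abs_nonneg _) h5).trans ?_
  rw [abs_le]
  constructor <;> linarith

lemma exp_sub_inv_exp_le {h : ℝ} (h₀ : 0 ≤ h) (h₁ : h ≤ 1 / 2) :
    Real.exp h - (Real.exp h)⁻¹ ≤ 4 * h := by
  have h2 : 1 - h ≤ (Real.exp h)⁻¹ := by
    rw [← Real.exp_neg]; linarith [Real.add_one_le_exp (-h)]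
  have h3 : Real.exp h ≤ (1 - h)⁻¹ := by
    rw [← inv_inv (Real.exp h)]; exact inv_anti₀ (by linarith) h2
  have h4 : (1 - h)⁻¹ ≤ 1 + 2 * h := by
    rw [inv_le_iff_one_le_mul₀ (by linarith)]; nlinarith
  linarith

/-- The integrand of the Cauchy integral, as a function of a complex parameter. -/
def complexCauchyIntegrand (β q : ℝ) (t : ℂ) : ℂ :=
  Complex.exp (-(β : ℂ) * (t ^ 2 - q + Complex.I * t)) * (2 * t + Complex.I) /
    (t ^ 2 - q + Complex.I * t)

lemma complexCauchyIntegrand_ofReal (β q t : ℝ) :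
    complexCauchyIntegrand β q t = cauchyIntegrand β q t := rfl

lemma complexParabola_re (q : ℝ) (t : ℂ) :
    (t ^ 2 - q + Complex.I * t).re = t.re ^ 2 - t.im ^ 2 - q - t.im := by
  simp [sq]; ring

lemma complexParabola_im (q : ℝ) (t : ℂ) :
    (t ^ 2 - q + Complex.I * t).im = t.re * (2 * t.im + 1) := by
  simp [sq]; ring

/-- Keeps the pole away from the strip. For `|Re t| ≥ b` the imaginary part of the parabola is at
least `5/6 |Re t|` in size; for `|Re t| ≤ b` its real part is at most `-(5/3 - 1/2 - 1/6) b = -b`.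
-/
lemma norm_deriv_complexParabola_le {b q : ℝ} (hb : 0 < b) (hb' : b ≤ 1 / 6) (hq : 5 / 3 * b ≤ q)
    {t : ℂ} (ht : |t.im| ≤ b / 2) :
    0 < ‖t ^ 2 - q + Complex.I * t‖ ∧
      ‖2 * t + Complex.I‖ ≤ 2 / b * ‖t ^ 2 - q + Complex.I * t‖ := by
  set p := t ^ 2 - (q : ℂ) + Complex.I * t with hp
  have hre := Complex.abs_re_le_norm p
  have him := Complex.abs_im_le_norm p
  rw [complexParabola_re] at hre
  rw [complexParabola_im, abs_mul] at him
  obtain ⟨ht₁, ht₂⟩ := abs_le.1 ht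
  rw [abs_of_pos (by linarith : 0 < 2 * t.im + 1)] at him
  have hnum : ‖2 * t + Complex.I‖ ≤ 2 * |t.re| + 7 / 6 := by
    refine (Complex.norm_le_abs_re_add_abs_im _).trans ?_
    have h1 : (2 * t + Complex.I).re = 2 * t.re := by simp
    have h2 : (2 * t + Complex.I).im = 2 * t.im + 1 := by simp
    rw [h1, h2, abs_mul, abs_two, abs_of_pos (by linarith : 0 < 2 * t.im + 1)]
    linarith
  have hu := abs_nonneg t.re
  suffices h : b * (2 * |t.re| + 7 / 6) ≤ 2 * ‖p‖ by
    refine ⟨by nlinarith [mul_nonneg hb.le hu], hnum.trans ?_⟩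
    rw [div_mul_eq_mul_div, le_div_iff₀ hb]
    linarith
  rcases le_total b |t.re| with hle | hle
  · have h1 : 5 / 6 * |t.re| ≤ ‖p‖ := by nlinarith
    nlinarith
  · have h1 : t.re ^ 2 ≤ b / 6 := by rw [← sq_abs]; nlinarith
    have h2 : b ≤ ‖p‖ := by
      have := neg_le_of_abs_le hre
      nlinarith [sq_nonneg t.im]
    nlinarith

lemma norm_complexCauchyIntegrand_le {β b q : ℝ} (hb : 0 < b) (hb' : b ≤ 1 / 6)
    (hq : 5 / 3 * b ≤ q) {t : ℂ} (ht : |t.im| ≤ b / 2) :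
    ‖complexCauchyIntegrand β q t‖ ≤
      Real.exp (-β * (t.re ^ 2 - t.im ^ 2 - q - t.im)) * (2 / b) := by
  obtain ⟨h0, h1⟩ := norm_deriv_complexParabola_le hb hb' hq ht
  rw [complexCauchyIntegrand, norm_div, norm_mul, norm_exp_neg_mul, complexParabola_re,
    div_le_iff₀ h0, mul_assoc]
  exact mul_le_mul_of_nonneg_left h1 (Real.exp_pos _).le

lemma differentiableAt_complexCauchyIntegrand {β b q : ℝ} (hb : 0 < b) (hb' : b ≤ 1 / 6)
    (hq : 5 / 3 * b ≤ q) {t : ℂ} (ht : |t.im| ≤ b / 2) :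
    DifferentiableAt ℂ (complexCauchyIntegrand β q) t := by
  have h0 := norm_pos_iff.1 (norm_deriv_complexParabola_le hb hb' hq ht).1
  unfold complexCauchyIntegrand
  fun_prop (disch := assumption)

lemma bParam_eq {β : ℝ} (hβ : 0 < β) : bParam β = 1 / (2 * max β 3) := by
  rw [bParam]
  rcases le_total β 3 with h | h
  · rw [max_eq_right h, min_eq_right]
    · norm_num
    · exact one_div_le_one_div_of_le (by positivity) (by linarith)
  · rw [max_eq_left h, min_eq_left]
    exact one_div_le_one_div_of_le (by positivity) (by linarith)

lemma bParam_pos {β : ℝ} (hβ : 0 < β) : 0 < bParam β := by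
  rw [bParam_eq hβ]; positivity

lemma bParam_le (β : ℝ) : bParam β ≤ 1 / 6 := min_le_right _ _

lemma mul_bParam_le {β : ℝ} (hβ : 0 < β) : β * bParam β ≤ 1 / 2 := by
  calc β * bParam β ≤ β * (1 / (2 * β)) := mul_le_mul_of_nonneg_left (min_le_left _ _) hβ.le
    _ = 1 / 2 := by field_simp

lemma le_zetaParam {β : ℝ} (hβ : 0 < β) : 5 / 3 * bParam β ≤ zetaParam β := by
  rw [zetaParam]
  nlinarith [bParam_pos hβ, bParam_le β]

lemma mul_zetaParam_le {β : ℝ} (hβ : 0 < β) : β * zetaParam β ≤ 1 := by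
  rw [zetaParam]
  nlinarith [bParam_pos hβ, mul_bParam_le hβ, bParam_le β]

lemma contourPoint_sub (β t x : ℝ) :
    contourPoint β t - (x : ℂ) = parabola (zetaParam β + x) t := by
  rw [contourPoint, parabola]; push_cast; ring

lemma rationalApprox_eq (β T : ℝ) (J : ℕ) (x : ℝ) :
    rationalApprox β T J x = -(2 * π * Complex.I : ℂ)⁻¹ * (Real.exp (-β * x) : ℂ) *
      ∑ s ∈ gaussNodes J, (gaussWeight J s : ℂ) *
        ((T : ℂ) * complexCauchyIntegrand β (zetaParam β + x) (T * s)) := by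
  rw [rationalApprox, Finset.mul_sum]
  refine Finset.sum_congr rfl fun s _ => ?_
  rw [← Complex.ofReal_mul, complexCauchyIntegrand_ofReal, cauchyIntegrand, ← contourPoint_sub,
    residue]
  have h : Complex.exp (-(β : ℂ) * contourPoint β (T * s)) =
      Real.exp (-β * x) * Complex.exp (-(β : ℂ) * (contourPoint β (T * s) - x)) := by
    rw [Complex.ofReal_exp, ← Complex.exp_add]
    congr 1
    push_cast
    ring
  rw [h]
  simp only [div_eq_mul_inv]
  ring

/-- The quadrature error for the truncated Cauchy integral. -/
lemma norm_integral_sub_gauss_cauchyIntegrand_le {β T x : ℝ} (hβ : 0 < β) (hT : 1 ≤ T)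
    (hx : 0 ≤ x) (J : ℕ) :
    ‖(∫ t in (-T)..T, cauchyIntegrand β (zetaParam β + x) t) -
      ∑ s ∈ gaussNodes J, (gaussWeight J s : ℂ) *
        ((T : ℂ) * complexCauchyIntegrand β (zetaParam β + x) (T * s))‖ ≤
      Real.exp (β * x) * (32 * T * max β 3 * Real.exp (3 / 2) /
        (1 - Real.exp (-(1 / (8 * T * max β 3)))) * Real.exp (-((J : ℝ) / (4 * T * max β 3)))) := by
  set m := max β 3 with hm
  have hm3 : 3 ≤ m := le_max_right _ _
  -- Chosen so that `2 T h = b / 2`: the scaled ellipse of parameter `e^h` fits in the strip.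
  set h := 1 / (8 * T * m) with hh
  set q := zetaParam β + x with hq
  have hT0 : 0 < T := by linarith
  have hm0 : 0 < m := by linarith
  have hh0 : 0 < h := by positivity
  have hh2 : h ≤ 1 / 2 := by
    rw [hh]; exact one_div_le_one_div_of_le (by norm_num) (by nlinarith)
  have hρ : 1 < Real.exp h := Real.one_lt_exp_iff.2 hh0
  have hb := bParam_pos hβ
  have hb' := bParam_le β
  have hbq : 5 / 3 * bParam β ≤ q := (le_zetaParam hβ).trans (by linarith)
  have him {w : ℂ} (h₁ : (Real.exp h)⁻¹ ≤ ‖w‖) (h₂ : ‖w‖ ≤ Real.exp h) :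
      |((T : ℂ) * joukowsky w).im| ≤ bParam β / 2 := by
    have h3 := abs_im_joukowsky_le hρ h₁ h₂
    have h4 := exp_sub_inv_exp_le hh0.le hh2
    rw [Complex.im_ofReal_mul, abs_mul, abs_of_pos hT0]
    calc T * |(joukowsky w).im| ≤ T * (2 * h) := mul_le_mul_of_nonneg_left (by linarith) hT0.le
      _ = bParam β / 2 := by rw [bParam_eq hβ, ← hm, hh]; field_simp; norm_num
  have hdiff {w : ℂ} (h₁ : (Real.exp h)⁻¹ ≤ ‖w‖) (h₂ : ‖w‖ ≤ Real.exp h) :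
      DifferentiableAt ℂ (fun s : ℂ => (T : ℂ) * complexCauchyIntegrand β q (T * s))
        (joukowsky w) :=
    ((differentiableAt_complexCauchyIntegrand (β := β) hb hb' hbq (him h₁ h₂)).comp (joukowsky w)
      (f := fun s : ℂ => (T : ℂ) * s) (by fun_prop)).const_mul _
  have hbound {w : ℂ} (h₁ : (Real.exp h)⁻¹ ≤ ‖w‖) (h₂ : ‖w‖ ≤ Real.exp h) :
      ‖(T : ℂ) * complexCauchyIntegrand β q (T * joukowsky w)‖ ≤
        Real.exp (β * x) * (4 * T * m * Real.exp (3 / 2)) := by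
    set t := (T : ℂ) * joukowsky w with ht
    have hv := him h₁ h₂
    have h3 := norm_complexCauchyIntegrand_le (β := β) hb hb' hbq hv
    -- The exponent `3/2` is `1 + 1/4 + 1/4`, from `βζ`, `β Im t` and `β (Im t) ^ 2`.
    have h4 : Real.exp (-β * (t.re ^ 2 - t.im ^ 2 - q - t.im)) ≤
        Real.exp (β * x) * Real.exp (3 / 2) := by
      rw [← Real.exp_add, Real.exp_le_exp, hq]
      have h5 := mul_zetaParam_le hβ
      have h6 : β * |t.im| ≤ 1 / 4 := by nlinarith [mul_bParam_le hβ]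
      have h7 : β * t.im ≤ 1 / 4 := (mul_le_mul_of_nonneg_left (le_abs_self _) hβ.le).trans h6
      have h8 : β * t.im ^ 2 ≤ 1 / 4 := by
        rw [← sq_abs]
        nlinarith [mul_nonneg hβ.le (abs_nonneg t.im), abs_nonneg t.im]
      nlinarith [mul_nonneg hβ.le (sq_nonneg t.re)]
    have h5 : 2 / bParam β = 4 * m := by rw [bParam_eq hβ, ← hm]; field_simp; norm_num
    rw [norm_mul, Complex.norm_real, norm_of_nonneg hT0.le]
    rw [h5] at h3
    calc T * ‖complexCauchyIntegrand β q t‖ ≤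
          T * ((Real.exp (β * x) * Real.exp (3 / 2)) * (4 * m)) := by
          refine mul_le_mul_of_nonneg_left (h3.trans ?_) hT0.le
          exact mul_le_mul_of_nonneg_right h4 (by positivity)
      _ = _ := by ring
  have hcont : Continuous fun y : ℝ => (T : ℂ) * complexCauchyIntegrand β q (T * y) := by
    have h1 := (continuous_cauchyIntegrand β (by linarith : 0 < q)).comp
      (continuous_const.mul continuous_id : Continuous fun y : ℝ => T * y)
    have h2 : (fun y : ℝ => (T : ℂ) * complexCauchyIntegrand β q (T * y)) =
        fun y : ℝ => (T : ℂ) * cauchyIntegrand β q (T * y) := by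
      ext y
      rw [← Complex.ofReal_mul, complexCauchyIntegrand_ofReal]
    rw [h2]
    exact continuous_const.mul h1
  have hint : ∫ t in (-T)..T, cauchyIntegrand β q t =
      ∫ y in (-1 : ℝ)..1, (T : ℂ) * complexCauchyIntegrand β q (T * y) := by
    have := intervalIntegral.smul_integral_comp_mul_left (a := -1) (b := 1)
      (cauchyIntegrand β q) T
    rw [mul_neg, mul_one] at this
    rw [← this, ← intervalIntegral.integral_smul]
    refine intervalIntegral.integral_congr fun y _ => ?_
    simp only [Complex.real_smul, ← Complex.ofReal_mul, complexCauchyIntegrand_ofReal]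
  have hmain := norm_integral_sub_gauss_le
    (g := fun s : ℂ => (T : ℂ) * complexCauchyIntegrand β q (T * s)) hρ
    (fun w h₁ h₂ => hdiff h₁ h₂) (fun w h₁ h₂ => hbound h₁ h₂) hcont.continuousOn J
  rw [hint]
  refine hmain.trans (le_of_eq ?_)
  rw [← Real.exp_neg, ← Real.exp_nat_mul]
  have hJ : ((2 * J : ℕ) : ℝ) * -h = -((J : ℝ) / (4 * T * m)) := by
    rw [hh]; push_cast; field_simp; ring
  rw [hJ]
  ring

lemma sqrt_five_mul_le {β : ℝ} (hβ : 0 < β) : √5 * √(π / β) / (2 * π) ≤ √(2 / (β * π)) := by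
  refine Real.le_sqrt_of_sq_le ?_
  rw [div_pow, mul_pow, Real.sq_sqrt (by norm_num), Real.sq_sqrt (by positivity)]
  have : 5 * (π / β) / (2 * π) ^ 2 = (5 / 4) / (β * π) := by
    field_simp
    norm_num
  rw [this]
  gcongr
  norm_num

end ParabolicQuadrature

end

/-! ### Combining truncation and quadrature errors -/

open ParabolicQuadrature in
theorem mainTheorem9 (β T : ℝ) (hβ : 0 < β) (hT : 1 ≤ T) (J : ℕ) (x : ℝ) (hx : 0 ≤ x) :
    ‖(Real.exp (-β * x) : ℂ) - ParabolicQuadrature.rationalApprox β T J x‖ ≤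
      Real.sqrt (2 / (β * Real.pi)) * Real.exp (1 - β * T ^ 2) +
        64 * T ^ 2 * max β 3 * Real.exp (3 / 2) / (1 - Real.exp (-(1 / (8 * T * max β 3)))) *
          Real.exp (-((J : ℝ) / (4 * T * max β 3))) := by
  set m := max β 3 with hm
  have hm3 : 3 ≤ m := le_max_right _ _
  have hq : 0 < zetaParam β + x := by linarith [le_zetaParam hβ, bParam_pos hβ]
  have htrunc := norm_integral_cauchyIntegrand_add_two_pi_I_le hβ hq hT
  have hquad := norm_integral_sub_gauss_cauchyIntegrand_le hβ hT hx J
  rw [← hm] at hquad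
  set S := ∑ s ∈ gaussNodes J, (gaussWeight J s : ℂ) *
        ((T : ℂ) * complexCauchyIntegrand β (zetaParam β + x) (T * s)) with hS
  set I := ∫ t in (-T)..T, cauchyIntegrand β (zetaParam β + x) t with hI
  have hpi : (2 * Real.pi * Complex.I : ℂ) ≠ 0 := by
    simp [Real.pi_ne_zero]
  have heq : (Real.exp (-β * x) : ℂ) - rationalApprox β T J x =
      (2 * Real.pi * Complex.I : ℂ)⁻¹ * (Real.exp (-β * x) : ℂ) *
        ((I + 2 * Real.pi * Complex.I) - (I - S)) := by
    rw [rationalApprox_eq, ← hS]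
    field_simp
    ring
  have hnorm : ‖(2 * Real.pi * Complex.I : ℂ)⁻¹ * (Real.exp (-β * x) : ℂ)‖ =
      Real.exp (-β * x) / (2 * Real.pi) := by
    rw [norm_mul, norm_inv, norm_mul, norm_mul, Complex.norm_I, Complex.norm_real,
      Complex.norm_real, Real.norm_of_nonneg Real.pi_pos.le,
      Real.norm_of_nonneg (Real.exp_pos _).le, Complex.norm_ofNat]
    ring
  rw [heq, norm_mul, hnorm]
  set E := Real.exp (3 / 2) / (1 - Real.exp (-(1 / (8 * T * m)))) *
    Real.exp (-((J : ℝ) / (4 * T * m))) with hE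
  have hE0 : 0 ≤ E := by
    have : Real.exp (-(1 / (8 * T * m))) ≤ 1 :=
      Real.exp_le_one_iff.2 (neg_nonpos.2 (by positivity))
    have := sub_nonneg.2 this
    positivity
  have h1 : Real.exp (-β * x) / (2 * Real.pi) * (√5 * Real.exp (β * (zetaParam β + x)) *
      (Real.exp (-β * T ^ 2) * √(Real.pi / β))) ≤
        √(2 / (β * Real.pi)) * Real.exp (1 - β * T ^ 2) := by
    have hexp : Real.exp (-β * x) * Real.exp (β * (zetaParam β + x)) * Real.exp (-β * T ^ 2) ≤
        Real.exp (1 - β * T ^ 2) := by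
      rw [← Real.exp_add, ← Real.exp_add, Real.exp_le_exp]
      linarith [mul_zetaParam_le hβ]
    calc _ = (√5 * √(Real.pi / β) / (2 * Real.pi)) * (Real.exp (-β * x) *
          Real.exp (β * (zetaParam β + x)) * Real.exp (-β * T ^ 2)) := by ring
      _ ≤ _ := mul_le_mul (sqrt_five_mul_le hβ) hexp (by positivity) (by positivity)
  have h2 : Real.exp (-β * x) / (2 * Real.pi) * (Real.exp (β * x) * (32 * T * m *
      Real.exp (3 / 2) / (1 - Real.exp (-(1 / (8 * T * m)))) *
        Real.exp (-((J : ℝ) / (4 * T * m))))) ≤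
      64 * T ^ 2 * m * Real.exp (3 / 2) / (1 - Real.exp (-(1 / (8 * T * m)))) *
          Real.exp (-((J : ℝ) / (4 * T * m))) := by
    have hcancel : Real.exp (-β * x) * Real.exp (β * x) = 1 := by
      rw [← Real.exp_add]; simp
    calc _ = (Real.exp (-β * x) * Real.exp (β * x)) * (32 * T * m / (2 * Real.pi)) * E := by
          rw [hE]; ring
      _ ≤ (64 * T ^ 2 * m) * E := by
          rw [hcancel, one_mul]
          -- There is ample room: `32 / (2π) ≤ 64`, and `T ≤ T ^ 2` since `T ≥ 1`.
          refine mul_le_mul_of_nonneg_right ?_ hE0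
          rw [div_le_iff₀ (by positivity)]
          nlinarith [Real.pi_gt_three, mul_nonneg (sub_nonneg.2 hT) (by positivity : 0 ≤ T * m),
            mul_pos (by positivity : 0 < T ^ 2 * m) (sub_pos.2 Real.pi_gt_three)]
      _ = _ := by rw [hE]; ring
  refine le_trans ?_ (add_le_add h1 h2)
  rw [← mul_add]
  exact mul_le_mul_of_nonneg_left ((norm_sub_le _ _).trans (add_le_add htrunc hquad))
    (by positivity)
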